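/- Let $G$ be an undirected graph with node set $[n]=\{1,\dots,n\}$, and let $K_1,\dots,K_m\subseteq[n]$ be a clique cover of $G$: every $K_j$ is a clique of $G$, every node of $G$ lies in some $K_j$, and both ends of every edge of $G$ lie in a common $K_j$. For each $j\in[m]$ introduce a slack index $n+j$ and put $\bar K_j=K_j\cup\{n+j\}$. Let $c\in\mathbb R^{n+m}$ be a cost vector (in particular one with $c_{n+j}=0$ for all $j\in[m]$) and let $T>0$. The smoothed clique cover relaxation is the problem $$\max_{x\in[0,1]^{n+m}}\ \langle c,x\rangle - T\sum_{i=1}^{n+m}\bigl(x_i\log x_i-x_i\bigr)\quad\text{s.t.}\quad \sum_{i\in\bar K_j}x_i=1,\ \ j\in[m],$$ where $0\log 0=0$. The naive Bregman (Sinkhorn) method starts from $x_i=\exp(c_i/T)$, $i\in[n+m]$, and repeats outer iterations indefinitely; one outer iteration processes the cliques $j=1,2,\dots,m$ in this order, and processing $j$ means computing $s=\sum_{i\in\bar K_j}x_i$ and replacing $x_i$ by $x_i/s$ for all $i\in\bar K_j$, while all other coordinates are kept. Then the smoothed clique cover relaxation has exactly one solution $x^*$, and the iterates of the method converge to $x^*$: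 the vectors obtained after $k$ outer iterations converge to $x^*$ as $k\to\infty$, and so do, for every $r\in\{0,\dots,m\}$, the vectors obtained after $k$ outer iterations followed by the processing of the first $r$ cliques. -/

import Mathlib

open Filter Topology

namespace CliqueCover

/-- The sets `K j`, `j ∈ [m]`, form a clique cover of the graph `G` on the node set `[n]`:
each of them is a clique, and together they cover all nodes and all edges. -/
structure IsCliqueCover {n m : ℕ} (G : SimpleGraph (Fin n)) (K : Fin m → Finset (Fin n)) :
    Prop where
  isClique : ∀ j, G.IsClique (K j : Set (Fin n))
  covers_nodes : ∀ i, ∃ j, i ∈ K j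
  covers_edges : ∀ i i', G.Adj i i' → ∃ j, i ∈ K j ∧ i' ∈ K j

/-- The index set `[n + m]`: `Sum.inl i` is the node `i ∈ [n]`, and `Sum.inr j` is the slack
index `n + j` of the clique `j ∈ [m]`. -/
abbrev Idx (n m : ℕ) : Type := Fin n ⊕ Fin m

/-- The clique with its slack index, `K̄ j = K j ∪ {n + j}`. -/
def extClique {n m : ℕ} (K : Fin m → Finset (Fin n)) (j : Fin m) : Finset (Idx n m) :=
  (K j).disjSum {j}

/-- The feasible set of the relaxation: `x ∈ [0,1]^(n+m)` with `∑_{i ∈ K̄ j} x i = 1` for all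
`j ∈ [m]`. -/
def feasibleSet {n m : ℕ} (K : Fin m → Finset (Fin n)) : Set (Idx n m → ℝ) :=
  {x | (∀ i, x i ∈ Set.Icc (0 : ℝ) 1) ∧ ∀ j, ∑ i ∈ extClique K j, x i = 1}

/-- The shifted entropy `H(x) = -∑ i, (x i * log (x i) - x i)`, with `0 * log 0 = 0`. -/
noncomputable def entropy {n m : ℕ} (x : Idx n m → ℝ) : ℝ :=
  -∑ i, (x i * Real.log (x i) - x i)

/-- The smoothed objective `⟨c, x⟩ + T * H(x)`. -/
noncomputable def smoothedObjective {n m : ℕ} (c : Idx n m → ℝ) (T : ℝ) (x : Idx n m → ℝ) : ℝ :=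
  ∑ i, c i * x i + T * entropy x

/-- `x` is a solution of the smoothed clique cover relaxation: it is feasible and maximizes the
smoothed objective over the feasible set. -/
def IsSolution {n m : ℕ} (K : Fin m → Finset (Fin n)) (c : Idx n m → ℝ) (T : ℝ)
    (x : Idx n m → ℝ) : Prop :=
  x ∈ feasibleSet K ∧ IsMaxOn (smoothedObjective c T) (feasibleSet K) x

/-- One inner step: divide the coordinates in `K̄ j` by their sum, keep all the others. -/
noncomputable def normalizeClique {n m : ℕ} (K : Fin m → Finset (Fin n)) (x : Idx n m → ℝ)
    (j : Fin m) : Idx n m → ℝ :=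
  fun i => if i ∈ extClique K j then x i / ∑ l ∈ extClique K j, x l else x i

/-- The first `r` inner steps of one pass of the loop over the cliques `1, …, m`, in this order. -/
noncomputable def partialSweep {n m : ℕ} (K : Fin m → Finset (Fin n)) (r : ℕ)
    (x : Idx n m → ℝ) : Idx n m → ℝ :=
  ((List.finRange m).take r).foldl (normalizeClique K) x

/-- One outer iteration: a full pass over the cliques `1, …, m`. -/
noncomputable def sweep {n m : ℕ} (K : Fin m → Finset (Fin n)) (x : Idx n m → ℝ) :
    Idx n m → ℝ :=
  (List.finRange m).foldl (normalizeClique K) x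

/-- The state of the algorithm after `k` outer iterations, started at `x = exp (c / T)`. -/
noncomputable def outerIterate {n m : ℕ} (K : Fin m → Finset (Fin n)) (c : Idx n m → ℝ) (T : ℝ)
    (k : ℕ) : Idx n m → ℝ :=
  (sweep K)^[k] (fun i => Real.exp (c i / T))

/-- The state of the algorithm after `k` outer iterations and `r` further inner steps. -/
noncomputable def innerIterate {n m : ℕ} (K : Fin m → Finset (Fin n)) (c : Idx n m → ℝ) (T : ℝ)
    (k r : ℕ) : Idx n m → ℝ :=
  partialSweep K r (outerIterate K c T k)

end CliqueCover

/-!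
Dividing the coordinates in `S` by their sum is the Bregman projection, with respect to the
Kullback-Leibler divergence, onto the affine subspace `∑ i ∈ S, z i = 1`. For a point `p` of all
these subspaces, the divergence from `p` to the iterates is therefore nonincreasing, and if `p` is
positive it confines them to a compact set of positive vectors. A cluster point `y` is fixed by a
whole sweep, since the limit of the divergence leaves no room for a decrease at `y`; hence `y` lies
in all the subspaces. A step multiplies `x` by a constant on `S`, so `∑ i, v i * log (x i)` never
changes when `v` is a direction of all the subspaces; in the limit this makes `y` the projection of
the starting point onto their intersection. Thus there is only one cluster point. Finally,
maximizing the smoothed objective amounts to minimizing the divergence to `exp (c / T)`.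
-/

namespace CliqueCover

section Divergence

variable {ι : Type*} [Fintype ι] {x y z : ι → ℝ}

/-- The Kullback-Leibler divergence of unnormalized vectors, the Bregman divergence of
`∑ i, (x i * log (x i) - x i)`. It is meant for `0 < x i`; the formula then also covers `z i = 0`,
and `z i < 0` through `log |z i|`. -/
noncomputable def divergence (z x : ι → ℝ) : ℝ :=
  ∑ i, x i * InformationTheory.klFun (z i / x i)

theorem mul_klFun_div {a b : ℝ} (hb : b ≠ 0) :
    b * InformationTheory.klFun (a / b) = a * Real.log a - a * Real.log b - a + b := by
  rcases eq_or_ne a 0 with rfl | ha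
  · simp [InformationTheory.klFun_zero]
  · rw [InformationTheory.klFun_apply, Real.log_div ha hb]
    field_simp
    ring

theorem mul_klFun_div_nonneg {a b : ℝ} (ha : 0 ≤ a) (hb : 0 ≤ b) :
    0 ≤ b * InformationTheory.klFun (a / b) :=
  mul_nonneg hb (InformationTheory.klFun_nonneg (div_nonneg ha hb))

theorem divergence_nonneg (hz : ∀ i, 0 ≤ z i) (hx : ∀ i, 0 ≤ x i) : 0 ≤ divergence z x :=
  Finset.sum_nonneg fun i _ => mul_klFun_div_nonneg (hz i) (hx i)

theorem divergence_self (hx : ∀ i, x i ≠ 0) : divergence x x = 0 := by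
  simp [divergence, div_self (hx _), InformationTheory.klFun_one]

theorem eq_of_divergence_nonpos (hz : ∀ i, 0 ≤ z i) (hx : ∀ i, 0 < x i)
    (h : divergence z x ≤ 0) : z = x := by
  have hsum := h.antisymm (divergence_nonneg hz fun i => (hx i).le)
  rw [divergence, Finset.sum_eq_zero_iff_of_nonneg
    fun i _ => mul_klFun_div_nonneg (hz i) (hx i).le] at hsum
  funext i
  have hi := (mul_eq_zero_iff_left (hx i).ne').1 (hsum i (Finset.mem_univ i))
  rw [InformationTheory.klFun_eq_zero_iff (div_nonneg (hz i) (hx i).le)] at hi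
  exact eq_of_div_eq_one hi

theorem continuousAt_divergence (z : ι → ℝ) (hx : ∀ i, x i ≠ 0) :
    ContinuousAt (divergence z) x :=
  tendsto_finsetSum _ fun i _ =>
    have hi : ContinuousAt (fun x : ι → ℝ => x i) x := continuousAt_apply i x
    hi.mul (InformationTheory.continuous_klFun.continuousAt.comp
      (continuousAt_const.div hi (hx i)))

theorem divergence_eq_add_add_sum (z : ι → ℝ) (hx : ∀ i, x i ≠ 0) (hy : ∀ i, y i ≠ 0) :
    divergence z x = divergence z y + divergence y x +
      ∑ i, (z i - y i) * (Real.log (y i) - Real.log (x i)) := by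
  simp only [divergence, ← Finset.sum_add_distrib, mul_klFun_div (hx _), mul_klFun_div (hy _)]
  exact Finset.sum_congr rfl fun i _ => by ring

theorem exists_bounds_of_mul_klFun_div_le {a : ℝ} (ha : 0 < a) (C : ℝ) :
    ∃ l u : ℝ, 0 < l ∧
      ∀ b, 0 < b → b * InformationTheory.klFun (a / b) ≤ C → b ∈ Set.Icc l u := by
  refine ⟨Real.exp ((a * Real.log a - a - C) / a),
    2 * (C - a * Real.log a + a * Real.log (2 * a)), Real.exp_pos _, fun b hb h => ?_⟩
  rw [mul_klFun_div hb.ne'] at h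
  constructor
  · rw [← Real.le_log_iff_exp_le hb, div_le_iff₀ ha]
    linarith
  · -- The tangent of `log` at `2 * a` has slope `1 / (2 * a)`, so `a * log b` absorbs only `b / 2`.
    have hlog : Real.log b - Real.log (2 * a) ≤ b / (2 * a) - 1 := by
      rw [← Real.log_div hb.ne' (by positivity)]
      exact Real.log_le_sub_one_of_pos (by positivity)
    have hmul : a * (Real.log b - Real.log (2 * a)) ≤ b / 2 - a :=
      (mul_le_mul_of_nonneg_left hlog ha.le).trans_eq (by field_simp)
    linarith

theorem exists_isCompact_of_divergence_le (hz : ∀ i, 0 < z i) (C : ℝ) :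
    ∃ B : Set (ι → ℝ), IsCompact B ∧ (∀ x ∈ B, ∀ i, 0 < x i) ∧
      ∀ x, (∀ i, 0 < x i) → divergence z x ≤ C → x ∈ B := by
  choose l u hl hlu using fun i => exists_bounds_of_mul_klFun_div_le (hz i) C
  refine ⟨Set.univ.pi fun i => Set.Icc (l i) (u i), isCompact_univ_pi fun _ => isCompact_Icc,
    fun x hx i => (hl i).trans_le (hx i trivial).1, fun x hx h i _ => hlu i (x i) (hx i) ?_⟩
  exact (Finset.single_le_sum (fun j _ => mul_klFun_div_nonneg (hz j).le (hx j).le)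
    (Finset.mem_univ i)).trans h

end Divergence

section Projection

variable {ι : Type*} [Fintype ι] {A : Set (ι → ℝ)} {x y y' : ι → ℝ}

/-- `y` is the positive Bregman projection of `x` onto the affine subspace `A` with respect to
`divergence`. It is characterized by the Pythagorean identity rather than as a minimizer, because
the identity is what the convergence proof uses. -/
structure IsBregmanProjection (A : Set (ι → ℝ)) (x y : ι → ℝ) : Prop where
  pos : ∀ i, 0 < y i
  mem : y ∈ A
  pythagoras : ∀ z ∈ A, divergence z x = divergence z y + divergence y x

theorem IsBregmanProjection.of_sum_mul_log (hx : ∀ i, 0 < x i) (hy : ∀ i, 0 < y i) (hyA : y ∈ A)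
    (h : ∀ z ∈ A, ∑ i, (z - y) i * Real.log (y i) = ∑ i, (z - y) i * Real.log (x i)) :
    IsBregmanProjection A x y where
  pos := hy
  mem := hyA
  pythagoras z hz := by
    have horth : ∑ i, (z i - y i) * (Real.log (y i) - Real.log (x i)) = 0 := by
      simpa only [mul_sub, Finset.sum_sub_distrib, sub_eq_zero, Pi.sub_apply] using h z hz
    rw [divergence_eq_add_add_sum z (fun i => (hx i).ne') (fun i => (hy i).ne'), horth, add_zero]

theorem IsBregmanProjection.unique (h : IsBregmanProjection A x y)
    (h' : IsBregmanProjection A x y') : y = y' := by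
  have hnonneg := divergence_nonneg (fun i => (h'.pos i).le) (fun i => (h.pos i).le)
  refine eq_of_divergence_nonpos (fun i => (h.pos i).le) h'.pos ?_
  linarith [h.pythagoras y' h'.mem, h'.pythagoras y h.mem]

end Projection

section NormalizeOn

variable {ι : Type*} [DecidableEq ι] {S : Finset ι} {x : ι → ℝ}

/-- Divide the coordinates in `S` by their sum and keep all the others: `normalizeClique` for an
arbitrary finite set of indices. -/
noncomputable def normalizeOn (S : Finset ι) (x : ι → ℝ) : ι → ℝ :=
  fun i => if i ∈ S then x i / ∑ l ∈ S, x l else x i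

theorem normalizeOn_pos (S : Finset ι) (hx : ∀ i, 0 < x i) (i : ι) : 0 < normalizeOn S x i := by
  unfold normalizeOn
  split_ifs with hi
  · exact div_pos (hx i) (Finset.sum_pos (fun l _ => hx l) ⟨i, hi⟩)
  · exact hx i

theorem sum_normalizeOn (h : ∑ i ∈ S, x i ≠ 0) : ∑ i ∈ S, normalizeOn S x i = 1 := by
  have hS : ∀ i ∈ S, normalizeOn S x i = x i / ∑ l ∈ S, x l := fun _ hi => if_pos hi
  rw [Finset.sum_congr rfl hS, ← Finset.sum_div, div_self h]

theorem normalizeOn_eq_self (h : ∑ i ∈ S, x i = 1) : normalizeOn S x = x := by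
  funext i
  simp [normalizeOn, h]

theorem continuousAt_normalizeOn (S : Finset ι) (hx : ∀ i, 0 < x i) :
    ContinuousAt (normalizeOn S) x := by
  refine continuousAt_pi.2 fun i => ?_
  by_cases hi : i ∈ S
  · simp only [normalizeOn, if_pos hi]
    exact (continuousAt_apply i x).div (tendsto_finsetSum _ fun l _ => continuousAt_apply l x)
      (Finset.sum_pos (fun l _ => hx l) ⟨i, hi⟩).ne'
  · simp only [normalizeOn, if_neg hi]
    exact continuousAt_apply i x

theorem sum_mul_log_normalizeOn [Fintype ι] {v : ι → ℝ} (hv : ∑ i ∈ S, v i = 0)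
    (hx : ∀ i, 0 < x i) :
    ∑ i, v i * Real.log (normalizeOn S x i) = ∑ i, v i * Real.log (x i) := by
  set s := ∑ l ∈ S, x l with hs
  have hterm : ∀ i, v i * Real.log (normalizeOn S x i) =
      v i * Real.log (x i) - if i ∈ S then v i * Real.log s else 0 := by
    intro i
    unfold normalizeOn
    split_ifs with hi
    · have hs_pos : 0 < s := Finset.sum_pos (fun l _ => hx l) ⟨i, hi⟩
      rw [← hs, Real.log_div (hx i).ne' hs_pos.ne', mul_sub]
    · rw [sub_zero]
  rw [Finset.sum_congr rfl fun i _ => hterm i, Finset.sum_sub_distrib, Finset.sum_ite_mem,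
    Finset.univ_inter, ← Finset.sum_mul, hv, zero_mul, sub_zero]

theorem isBregmanProjection_normalizeOn [Fintype ι] (hS : S.Nonempty) (hx : ∀ i, 0 < x i) :
    IsBregmanProjection {z | ∑ i ∈ S, z i = 1} x (normalizeOn S x) := by
  have hsum := sum_normalizeOn (Finset.sum_pos (fun i _ => hx i) hS).ne'
  refine .of_sum_mul_log hx (normalizeOn_pos S hx) hsum fun z (hz : ∑ i ∈ S, z i = 1) =>
    sum_mul_log_normalizeOn ?_ hx
  simp only [Pi.sub_apply, Finset.sum_sub_distrib, hz, hsum, sub_self]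

end NormalizeOn

section NormalizeAlong

variable {ι : Type*} {L : List (Finset ι)} {S : Finset ι} {x z : ι → ℝ}

/-- The affine subspace of the vectors whose coordinates sum to `1` over each set in `L`. -/
def unitSumSet (L : List (Finset ι)) : Set (ι → ℝ) :=
  {z | ∀ S ∈ L, ∑ i ∈ S, z i = 1}

theorem mem_unitSumSet_cons :
    z ∈ unitSumSet (S :: L) ↔ ∑ i ∈ S, z i = 1 ∧ z ∈ unitSumSet L :=
  List.forall_mem_cons

theorem mem_unitSumSet_flatten_replicate (hz : z ∈ unitSumSet L) (k : ℕ) :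
    z ∈ unitSumSet (List.replicate k L).flatten := by
  intro S hS
  obtain ⟨L', hL', hSL'⟩ := List.mem_flatten.1 hS
  exact hz S (List.eq_of_mem_replicate hL' ▸ hSL')

variable [DecidableEq ι]

/-- Cyclic Bregman projection: normalize on the sets in `L` one after the other, from left to
right. -/
noncomputable def normalizeAlong (L : List (Finset ι)) (x : ι → ℝ) : ι → ℝ :=
  L.foldl (fun x S => normalizeOn S x) x

theorem normalizeAlong_cons (S : Finset ι) (L : List (Finset ι)) (x : ι → ℝ) :
    normalizeAlong (S :: L) x = normalizeAlong L (normalizeOn S x) :=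
  rfl

theorem iterate_normalizeAlong (L : List (Finset ι)) (k : ℕ) (x : ι → ℝ) :
    (normalizeAlong L)^[k] x = normalizeAlong (List.replicate k L).flatten x := by
  induction k generalizing x with
  | zero => rfl
  | succ k ih =>
    rw [Function.iterate_succ_apply, ih, List.replicate_succ, List.flatten_cons]
    simp only [normalizeAlong, List.foldl_append]

theorem normalizeAlong_pos (L : List (Finset ι)) (hx : ∀ i, 0 < x i) :
    ∀ i, 0 < normalizeAlong L x i := by
  induction L generalizing x with
  | nil => exact hx
  | cons S _ ih => exact ih (normalizeOn_pos S hx)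

theorem iterate_normalizeAlong_pos (L : List (Finset ι)) (hx : ∀ i, 0 < x i) (k : ℕ) :
    ∀ i, 0 < (normalizeAlong L)^[k] x i := by
  rw [iterate_normalizeAlong]
  exact normalizeAlong_pos _ hx

theorem normalizeAlong_eq_self (hx : x ∈ unitSumSet L) : normalizeAlong L x = x := by
  induction L with
  | nil => rfl
  | cons S L ih =>
    rw [mem_unitSumSet_cons] at hx
    rw [normalizeAlong_cons, normalizeOn_eq_self hx.1, ih hx.2]

theorem continuousAt_normalizeAlong (L : List (Finset ι)) (hx : ∀ i, 0 < x i) :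
    ContinuousAt (normalizeAlong L) x := by
  induction L generalizing x with
  | nil => exact continuousAt_id
  | cons S L ih =>
    exact ContinuousAt.comp (g := normalizeAlong L) (ih (normalizeOn_pos S hx))
      (continuousAt_normalizeOn S hx)

variable [Fintype ι]

theorem sum_mul_log_normalizeAlong {v : ι → ℝ} (hv : ∀ S ∈ L, ∑ i ∈ S, v i = 0)
    (hx : ∀ i, 0 < x i) :
    ∑ i, v i * Real.log (normalizeAlong L x i) = ∑ i, v i * Real.log (x i) := by
  induction L generalizing x with
  | nil => rfl
  | cons S L ih =>
    rw [List.forall_mem_cons] at hv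
    rw [normalizeAlong_cons, ih hv.2 (normalizeOn_pos S hx), sum_mul_log_normalizeOn hv.1 hx]

theorem divergence_normalizeOn_add (hz : ∑ i ∈ S, z i = 1) (hx : ∀ i, 0 < x i) :
    divergence z x = divergence z (normalizeOn S x) + divergence (normalizeOn S x) x :=
  have hS : S.Nonempty := Finset.nonempty_of_sum_ne_zero (hz.trans_ne one_ne_zero)
  (isBregmanProjection_normalizeOn hS hx).pythagoras z hz

theorem divergence_normalizeAlong_le (hz : z ∈ unitSumSet L) (hx : ∀ i, 0 < x i) :
    divergence z (normalizeAlong L x) ≤ divergence z x := by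
  induction L generalizing x with
  | nil => rfl
  | cons S L ih =>
    rw [mem_unitSumSet_cons] at hz
    have hpos := normalizeOn_pos S hx
    have hstep := divergence_nonneg (fun i => (hpos i).le) (fun i => (hx i).le)
    rw [normalizeAlong_cons]
    linarith [ih hz.2 hpos, divergence_normalizeOn_add hz.1 hx]

theorem mem_unitSumSet_of_divergence_le (hz : z ∈ unitSumSet L) (hx : ∀ i, 0 < x i)
    (h : divergence z x ≤ divergence z (normalizeAlong L x)) : x ∈ unitSumSet L := by
  induction L with
  | nil => exact List.forall_mem_nil _
  | cons S L ih =>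
    rw [mem_unitSumSet_cons] at hz ⊢
    rw [normalizeAlong_cons] at h
    have hpos := normalizeOn_pos S hx
    have hfix : normalizeOn S x = x := by
      refine eq_of_divergence_nonpos (fun i => (hpos i).le) hx ?_
      linarith [divergence_normalizeAlong_le hz.2 hpos, divergence_normalizeOn_add hz.1 hx]
    have hS : S.Nonempty := Finset.nonempty_of_sum_ne_zero (hz.1.trans_ne one_ne_zero)
    have hsum := sum_normalizeOn (Finset.sum_pos (fun i _ => hx i) hS).ne'
    rw [hfix] at h hsum
    exact ⟨hsum, ih hz.2 h⟩

end NormalizeAlong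

section Convergence

variable {ι : Type*} [Fintype ι] [DecidableEq ι] {L : List (Finset ι)} {x y p : ι → ℝ}

theorem antitone_divergence_iterate_normalizeAlong (hp : p ∈ unitSumSet L) (hx : ∀ i, 0 < x i) :
    Antitone fun k => divergence p ((normalizeAlong L)^[k] x) :=
  antitone_nat_of_succ_le fun k => by
    rw [Function.iterate_succ_apply']
    exact divergence_normalizeAlong_le hp (iterate_normalizeAlong_pos L hx k)

theorem exists_tendsto_divergence_iterate_normalizeAlong (hp : p ∈ unitSumSet L)
    (hp_nonneg : ∀ i, 0 ≤ p i) (hx : ∀ i, 0 < x i) :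
    ∃ d, Tendsto (fun k => divergence p ((normalizeAlong L)^[k] x)) atTop (𝓝 d) := by
  refine ⟨_, tendsto_atTop_ciInf (antitone_divergence_iterate_normalizeAlong hp hx) ⟨0, ?_⟩⟩
  rintro _ ⟨k, rfl⟩
  exact divergence_nonneg hp_nonneg fun i => (iterate_normalizeAlong_pos L hx k i).le

variable {l : Filter ℕ} [l.NeBot]

theorem mem_unitSumSet_of_tendsto {d : ℝ} (hp : p ∈ unitSumSet L)
    (hd : Tendsto (fun k => divergence p ((normalizeAlong L)^[k] x)) atTop (𝓝 d))
    (hy : ∀ i, 0 < y i) (hl : l ≤ atTop)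
    (hlim : Tendsto (fun k => (normalizeAlong L)^[k] x) l (𝓝 y)) : y ∈ unitSumSet L := by
  have hdiv_y : divergence p y = d :=
    tendsto_nhds_unique ((continuousAt_divergence p fun i => (hy i).ne').tendsto.comp hlim)
      (hd.mono_left hl)
  have hlim_succ : Tendsto (fun k => (normalizeAlong L)^[k + 1] x) l (𝓝 (normalizeAlong L y)) := by
    simp only [Function.iterate_succ_apply']
    exact (continuousAt_normalizeAlong L hy).tendsto.comp hlim
  have hdiv_sweep : divergence p (normalizeAlong L y) = d :=
    tendsto_nhds_unique
      ((continuousAt_divergence p fun i => (normalizeAlong_pos L hy i).ne').tendsto.comp hlim_succ)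
      ((hd.comp (tendsto_add_atTop_nat 1)).mono_left hl)
  exact mem_unitSumSet_of_divergence_le hp hy (hdiv_y.trans hdiv_sweep.symm).le

theorem isBregmanProjection_of_tendsto (hx : ∀ i, 0 < x i) (hy : ∀ i, 0 < y i)
    (hyL : y ∈ unitSumSet L) (hlim : Tendsto (fun k => (normalizeAlong L)^[k] x) l (𝓝 y)) :
    IsBregmanProjection (unitSumSet L) x y := by
  refine .of_sum_mul_log hx hy hyL fun z hz => ?_
  have hinvariant : ∀ k, ∑ i, (z - y) i * Real.log ((normalizeAlong L)^[k] x i) =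
      ∑ i, (z - y) i * Real.log (x i) := fun k => by
    rw [iterate_normalizeAlong]
    refine sum_mul_log_normalizeAlong (fun S hS => ?_) hx
    simp only [Pi.sub_apply, Finset.sum_sub_distrib, mem_unitSumSet_flatten_replicate hz k S hS,
      mem_unitSumSet_flatten_replicate hyL k S hS, sub_self]
  have hsum : Tendsto (fun k => ∑ i, (z - y) i * Real.log ((normalizeAlong L)^[k] x i)) l
      (𝓝 (∑ i, (z - y) i * Real.log (y i))) :=
    tendsto_finsetSum _ fun i _ => ((tendsto_pi_nhds.1 hlim i).log (hy i).ne').const_mul _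
  simp only [hinvariant] at hsum
  exact tendsto_nhds_unique hsum tendsto_const_nhds

theorem exists_isBregmanProjection_tendsto_iterate_normalizeAlong (hp : p ∈ unitSumSet L)
    (hp_pos : ∀ i, 0 < p i) (hx : ∀ i, 0 < x i) :
    ∃ y, IsBregmanProjection (unitSumSet L) x y ∧
      Tendsto (fun k => (normalizeAlong L)^[k] x) atTop (𝓝 y) := by
  obtain ⟨B, hB, hB_pos, hB_mem⟩ := exists_isCompact_of_divergence_le hp_pos (divergence p x)
  obtain ⟨d, hd⟩ :=
    exists_tendsto_divergence_iterate_normalizeAlong hp (fun i => (hp_pos i).le) hx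
  have hmem : ∀ k, (normalizeAlong L)^[k] x ∈ B := fun k =>
    hB_mem _ (iterate_normalizeAlong_pos L hx k)
      (antitone_divergence_iterate_normalizeAlong hp hx k.zero_le)
  have hcluster : ∀ y ∈ B, MapClusterPt y atTop (fun k => (normalizeAlong L)^[k] x) →
      IsBregmanProjection (unitSumSet L) x y := fun y hyB hy => by
    obtain ⟨U, hU, hlim⟩ := mapClusterPt_iff_ultrafilter.1 hy
    have hy_pos := hB_pos y hyB
    have hyL := mem_unitSumSet_of_tendsto hp hd hy_pos hU hlim
    exact isBregmanProjection_of_tendsto hx hy_pos hyL hlim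
  obtain ⟨y, hyB, hy⟩ :=
    hB.exists_mapClusterPt (tendsto_principal.2 (Eventually.of_forall hmem) : Tendsto _ atTop _)
  exact ⟨y, hcluster y hyB hy, hB.tendsto_nhds_of_unique_mapClusterPt (Eventually.of_forall hmem)
    fun y' hyB' hy' => (hcluster y' hyB' hy').unique (hcluster y hyB hy)⟩

end Convergence

section Relaxation

variable {n m : ℕ} {K : Fin m → Finset (Fin n)} {c : Idx n m → ℝ} {T : ℝ} {x y : Idx n m → ℝ}

/-- The extended cliques `K̄ 1, …, K̄ m` in the order in which the method processes them. -/
def extCliques (K : Fin m → Finset (Fin n)) : List (Finset (Idx n m)) :=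
  (List.finRange m).map (extClique K)

/-- The vector `exp (c / T)` at which the method starts. -/
noncomputable def startPoint (c : Idx n m → ℝ) (T : ℝ) : Idx n m → ℝ :=
  fun i => Real.exp (c i / T)

theorem startPoint_pos (c : Idx n m → ℝ) (T : ℝ) (i : Idx n m) : 0 < startPoint c T i :=
  Real.exp_pos _

theorem mem_unitSumSet_extCliques :
    x ∈ unitSumSet (extCliques K) ↔ ∀ j, ∑ i ∈ extClique K j, x i = 1 := by
  simp [unitSumSet, extCliques]

theorem exists_mem_extClique (hK : ∀ i, ∃ j, i ∈ K j) : ∀ i, ∃ j, i ∈ extClique K j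
  | .inl i => (hK i).imp fun _ hj => Finset.inl_mem_disjSum.2 hj
  | .inr j => ⟨j, Finset.inr_mem_disjSum.2 (Finset.mem_singleton_self j)⟩

theorem mem_feasibleSet_of_mem_unitSumSet (hK : ∀ i, ∃ j, i ∈ K j) (hx : ∀ i, 0 ≤ x i)
    (hsum : x ∈ unitSumSet (extCliques K)) : x ∈ feasibleSet K := by
  rw [mem_unitSumSet_extCliques] at hsum
  refine ⟨fun i => ⟨hx i, ?_⟩, hsum⟩
  obtain ⟨j, hj⟩ := exists_mem_extClique hK i
  exact (Finset.single_le_sum (fun l _ => hx l) hj).trans_eq (hsum j)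

theorem exists_pos_mem_unitSumSet_extCliques (K : Fin m → Finset (Fin n)) :
    ∃ p ∈ unitSumSet (extCliques K), ∀ i, 0 < p i := by
  refine ⟨Sum.elim (fun _ => 1 / (n + 1)) (fun j => 1 - (K j).card * (1 / (n + 1))),
    mem_unitSumSet_extCliques.2 fun j => ?_, ?_⟩
  · simp [extClique, Finset.sum_disjSum]
  · rintro (i | j)
    · simp only [Sum.elim_inl]
      positivity
    · have hcard : ((K j).card : ℝ) ≤ n := by exact_mod_cast card_finset_fin_le (K j)
      rw [Sum.elim_inr, mul_one_div, sub_pos, div_lt_one (by positivity)]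
      linarith

theorem smoothedObjective_eq_sub_divergence (hT : T ≠ 0) (c z : Idx n m → ℝ) :
    smoothedObjective c T z =
      T * ∑ i, startPoint c T i - T * divergence z (startPoint c T) := by
  rw [smoothedObjective, entropy, divergence, ← mul_sub, ← Finset.sum_sub_distrib,
    ← Finset.sum_neg_distrib, Finset.mul_sum, Finset.mul_sum, ← Finset.sum_add_distrib]
  refine Finset.sum_congr rfl fun i _ => ?_
  rw [mul_klFun_div (startPoint_pos c T i).ne', startPoint, Real.log_exp]
  field_simp
  ring

theorem IsBregmanProjection.isSolution_iff (hK : ∀ i, ∃ j, i ∈ K j) (hT : 0 < T)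
    (hx : IsBregmanProjection (unitSumSet (extCliques K)) (startPoint c T) x) :
    IsSolution K c T y ↔ y = x := by
  have hx_mem : x ∈ feasibleSet K :=
    mem_feasibleSet_of_mem_unitSumSet hK (fun i => (hx.pos i).le) hx.mem
  have hgap : ∀ z ∈ feasibleSet K,
      smoothedObjective c T x = smoothedObjective c T z + T * divergence z x := fun z hz => by
    rw [smoothedObjective_eq_sub_divergence hT.ne', smoothedObjective_eq_sub_divergence hT.ne',
      hx.pythagoras z (mem_unitSumSet_extCliques.2 hz.2)]
    ring
  constructor
  · rintro ⟨hy_mem, hy_max⟩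
    have hle : smoothedObjective c T x ≤ smoothedObjective c T y := hy_max hx_mem
    have hdiv : T * divergence y x ≤ 0 := by linarith [hgap y hy_mem]
    exact eq_of_divergence_nonpos (fun i => (hy_mem.1 i).1) hx.pos
      (nonpos_of_mul_nonpos_right hdiv hT)
  · rintro rfl
    refine ⟨hx_mem, isMaxOn_iff.2 fun z hz => ?_⟩
    rw [hgap z hz]
    exact le_add_of_nonneg_right (mul_nonneg hT.le
      (divergence_nonneg (fun i => (hz.1 i).1) fun i => (hx.pos i).le))

theorem partialSweep_eq_normalizeAlong (K : Fin m → Finset (Fin n)) (r : ℕ) :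
    partialSweep K r = normalizeAlong ((extCliques K).take r) := by
  funext x
  rw [extCliques, ← List.map_take, normalizeAlong, List.foldl_map]
  rfl

theorem outerIterate_eq_iterate_normalizeAlong (K : Fin m → Finset (Fin n)) (c : Idx n m → ℝ)
    (T : ℝ) (k : ℕ) :
    outerIterate K c T k = (normalizeAlong (extCliques K))^[k] (startPoint c T) := by
  have hsweep : sweep K = normalizeAlong (extCliques K) := by
    funext x
    rw [extCliques, normalizeAlong, List.foldl_map]
    rfl
  rw [← hsweep]
  rfl

theorem tendsto_innerIterate_of_tendsto_outerIterate (hx : ∀ i, 0 < x i)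
    (hsum : x ∈ unitSumSet (extCliques K)) (hlim : Tendsto (outerIterate K c T) atTop (𝓝 x))
    (r : ℕ) : Tendsto (fun k => innerIterate K c T k r) atTop (𝓝 x) := by
  have hfix : normalizeAlong ((extCliques K).take r) x = x :=
    normalizeAlong_eq_self fun S hS => hsum S (List.mem_of_mem_take hS)
  have hcont := (continuousAt_normalizeAlong ((extCliques K).take r) hx).tendsto
  rw [hfix] at hcont
  simp only [innerIterate, partialSweep_eq_normalizeAlong]
  exact hcont.comp hlim

end Relaxation

end CliqueCover

theorem mainTheorem3_general {n m : ℕ} (K : Fin m → Finset (Fin n)) (hK : ∀ i, ∃ j, i ∈ K j)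
    (c : CliqueCover.Idx n m → ℝ) (T : ℝ) (hT : 0 < T) :
    ∃ x : CliqueCover.Idx n m → ℝ,
      CliqueCover.IsSolution K c T x ∧
      (∀ y, CliqueCover.IsSolution K c T y → y = x) ∧
      Tendsto (fun k => CliqueCover.outerIterate K c T k) atTop (𝓝 x) ∧
      ∀ r ≤ m, Tendsto (fun k => CliqueCover.innerIterate K c T k r) atTop (𝓝 x) := by
  obtain ⟨p, hp, hp_pos⟩ := CliqueCover.exists_pos_mem_unitSumSet_extCliques K
  obtain ⟨x, hx, hlim⟩ :=
    CliqueCover.exists_isBregmanProjection_tendsto_iterate_normalizeAlong hp hp_pos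
      (CliqueCover.startPoint_pos c T)
  simp only [← CliqueCover.outerIterate_eq_iterate_normalizeAlong] at hlim
  exact ⟨x, (hx.isSolution_iff hK hT).2 rfl, fun _ => (hx.isSolution_iff hK hT).1, hlim,
    fun r _ => CliqueCover.tendsto_innerIterate_of_tendsto_outerIterate hx.pos hx.mem hlim r⟩

theorem mainTheorem3 {n m : ℕ} (G : SimpleGraph (Fin n)) (K : Fin m → Finset (Fin n))
    (hK : CliqueCover.IsCliqueCover G K) (c : CliqueCover.Idx n m → ℝ) (T : ℝ) (hT : 0 < T) :
    ∃ x : CliqueCover.Idx n m → ℝ,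
      CliqueCover.IsSolution K c T x ∧
      (∀ y, CliqueCover.IsSolution K c T y → y = x) ∧
      Tendsto (fun k => CliqueCover.outerIterate K c T k) atTop (𝓝 x) ∧
      ∀ r ≤ m, Tendsto (fun k => CliqueCover.innerIterate K c T k r) atTop (𝓝 x) :=
  mainTheorem3_general K hK.covers_nodes c T hT
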